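/- Let $k$ be a field of characteristic $0$, and let $\Theta$ be the variety of all commutative (not necessarily associative, nonunital) algebras over $k$. Let $\Theta^0$ be the category whose objects are the free algebras $F(X)$ of $\Theta$, one for each finite subset $X$ of a fixed countably infinite set of symbols, and whose morphisms are the $k$-algebra homomorphisms. Let $\mathfrak A$ be the group of all automorphisms of the category $\Theta^0$ and $\mathfrak Y\trianglelefteq\mathfrak A$ the subgroup of inner automorphisms, i.e. those isomorphic as functors to the identity functor. An automorphism $\Phi\in\mathfrak A$ is called strongly stable if it preserves all objects and there are bijections $s_F\colon F\to F$ ($F=F(X)\in\mathrm{Ob}\,\Theta^0$) with $s_F|_X=\mathrm{id}_X$ and $\Phi(\psi)=s_F\circ\psi\circ s_D^{-1}$ for every morphism $\psi\colon D\to F$. For $\varphi\in\mathrm{Aut}\,k$ (the group of field automorphisms of $k$) and $\alpha\in k^*$, say that a strongly stable automorphism $\Phi$ has type $(\varphi,\alpha)$ if the bijections $s_F$ can be chosen so that for all $F$, all $f,g\in F$ and all $c\in k$ $$s_F(f+g)=s_F(f)+s_F(g),\qquad s_F(cf)=\varphi(c)\,s_F(f),\qquad s_F(fg)=\alpha\,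 s_F(f)s_F(g).$$ Then $$\mathfrak A/\mathfrak Y\;\cong\;\mathrm{Aut}\,k .$$ More precisely: (1) every strongly stable automorphism has type $(\varphi,\alpha)$ for exactly one pair $(\varphi,\alpha)\in\mathrm{Aut}\,k\times k^*$, and for every such pair there is exactly one strongly stable automorphism $\Phi_{\varphi,\alpha}$ of type $(\varphi,\alpha)$; (2) $\Phi_{\varphi,\alpha}=\Phi_{\mathrm{id},\alpha}\circ\Phi_{\varphi,1}$, and $\Phi_{\mathrm{id},\alpha}$ is inner; (3) there is a group isomorphism $\mathfrak A/\mathfrak Y\to\mathrm{Aut}\,k$ that takes the coset of $\Phi_{\varphi,\alpha}$ to $\varphi$, for all $\varphi\in\mathrm{Aut}\,k$ and $\alpha\in k^*$. -/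

import Mathlib

open CategoryTheory

/-- The congruence on the free magma on `X` generated by commutativity. -/
def freeCommMagmaCon (X : Type*) : Con (FreeMagma X) :=
  conGen fun a b => ∃ u v : FreeMagma X, a = u * v ∧ b = v * u

/-- The free commutative (nonassociative) magma on `X`. -/
abbrev FreeCommMagma (X : Type*) : Type _ :=
  (freeCommMagmaCon X).Quotient

/-- The free commutative nonassociative (nonunital) algebra over `k` on the set `X`:
the magma algebra of the free commutative magma. -/
abbrev FreeCommNAAlgebra (k : Type*) [Field k] (X : Type*) : Type _ :=
  MonoidAlgebra k (FreeCommMagma X)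

namespace FreeCommNAAlgebra

/-- The free generator attached to `x`. -/
noncomputable def gen (k : Type*) [Field k] {X : Type*} (x : X) : FreeCommNAAlgebra k X :=
  MonoidAlgebra.ofMagma k (FreeCommMagma X) (FreeMagma.of x : FreeMagma X)

theorem magma_mul_comm {X : Type*} (a b : FreeCommMagma X) : a * b = b * a := by
  induction a using Con.induction_on with
  | H a =>
    induction b using Con.induction_on with
    | H b =>
      exact (Con.eq _).2 (ConGen.Rel.of _ _ ⟨a, b, rfl, rfl⟩)

/-- The free commutative algebra is commutative. -/
theorem mul_comm' (k : Type*) [Field k] {X : Type*} (f g : FreeCommNAAlgebra k X) :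
    f * g = g * f := by
  induction f using MonoidAlgebra.induction_linear with
  | zero => simp
  | add f f' h h' => rw [add_mul, mul_add, h, h']
  | single a r =>
    induction g using MonoidAlgebra.induction_linear with
    | zero => simp
    | add f f' h h' => rw [add_mul, mul_add, h, h']
    | single b s =>
      rw [MonoidAlgebra.single_mul_single, MonoidAlgebra.single_mul_single,
        magma_mul_comm, mul_comm]

/-- The universal property: every map from `X` to a commutative nonassociative algebra extends
uniquely to a homomorphism of algebras. -/
theorem existsUnique_lift (k : Type*) [Field k] {X A : Type*} [NonUnitalNonAssocCommRing A]
    [Module k A] [IsScalarTower k A A] [SMulCommClass k A A] (f : X → A) :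
    ∃! F : FreeCommNAAlgebra k X →ₙₐ[k] A, ∀ x, F (gen k x) = f x := by
  have hle : freeCommMagmaCon X ≤ Con.ker (FreeMagma.lift f) := by
    refine Con.conGen_le.2 ?_
    rintro _ _ ⟨u, v, rfl, rfl⟩
    simp [Con.ker_rel, mul_comm]
  let m : FreeCommMagma X →ₙ* A :=
    { toFun := fun a => Con.liftOn a (FreeMagma.lift f) fun a b h => hle h
      map_mul' := by
        intro a b
        induction a using Con.induction_on with
        | H a =>
          induction b using Con.induction_on with
          | H b => exact map_mul (FreeMagma.lift f) a b }
  have hm : ∀ x : X, m ((FreeMagma.of x : FreeMagma X) : FreeCommMagma X) = f x := fun x => rfl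
  refine ⟨MonoidAlgebra.liftMagma k m, fun x => ?_, fun G hG => ?_⟩
  · have := DFunLike.congr_fun ((MonoidAlgebra.liftMagma k).symm_apply_apply m)
      ((FreeMagma.of x : FreeMagma X) : FreeCommMagma X)
    exact this.trans (hm x)
  · rw [← (MonoidAlgebra.liftMagma k).apply_symm_apply G]
    congr 1
    ext a
    induction a using Con.induction_on with
    | H a =>
      induction a using FreeMagma.recOnMul with
      | ih1 x => exact (hG x).trans (hm x).symm
      | ih2 a b ha hb =>
        rw [Con.coe_mul, map_mul, map_mul, ha, hb]

end FreeCommNAAlgebra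

/-- The objects of the category of finitely generated free commutative algebras over `k`: one
object `F(X)` for every finite subset `X` of the countable set of symbols `{x₀, x₁, x₂, …}`. -/
structure FreeCommAlgCat (k : Type*) [Field k] where
  /-- the indices of the free generators -/
  gens : Finset ℕ

namespace FreeCommAlgCat

/-- The free commutative algebra `F(X)` that is the object. -/
abbrev Carrier {k : Type*} [Field k] (A : FreeCommAlgCat k) : Type _ :=
  FreeCommNAAlgebra k A.gens

/-- Morphisms are the homomorphisms of `k`-algebras. -/
noncomputable instance category (k : Type*) [Field k] : Category (FreeCommAlgCat k) where
  Hom A B := A.Carrier →ₙₐ[k] B.Carrier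
  id A := NonUnitalAlgHom.id k A.Carrier
  comp f g := NonUnitalAlgHom.comp g f

/-- The underlying algebra homomorphism of a morphism. -/
def toAlgHom {k : Type*} [Field k] {A B : FreeCommAlgCat k} (f : A ⟶ B) :
    A.Carrier →ₙₐ[k] B.Carrier := f

/-- The group `𝔄` of all automorphisms of the category (invertible endofunctors, with
composition: `Φ * Ψ` is `Φ ∘ Ψ`). -/
abbrev Autos (k : Type*) [Field k] : Type _ := Aut (Cat.of (FreeCommAlgCat k))

/-- The functor underlying an automorphism of the category. -/
abbrev functor {k : Type*} [Field k] (Φ : Autos k) : FreeCommAlgCat k ⥤ FreeCommAlgCat k :=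
  Φ.hom.toFunctor

/-- The subgroup `𝔜` of inner automorphisms: those isomorphic, as functors, to the identity. -/
def inner (k : Type*) [Field k] : Subgroup (Autos k) where
  carrier := {Φ | Nonempty (functor Φ ≅ 𝟭 (FreeCommAlgCat k))}
  one_mem' := ⟨Iso.refl _⟩
  mul_mem' := by
    rintro Φ Ψ ⟨a⟩ ⟨b⟩
    exact ⟨(Functor.isoWhiskerRight b (functor Φ)).trans ((Functor.leftUnitor _).trans a)⟩
  inv_mem' := by
    rintro Φ ⟨a⟩
    have h : functor Φ⁻¹ ⋙ functor Φ = 𝟭 _ := congrArg Cat.Hom.toFunctor Φ.inv_hom_id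
    exact ⟨(Functor.rightUnitor _).symm.trans
      ((Functor.isoWhiskerLeft (functor Φ⁻¹) a.symm).trans (eqToIso h))⟩

instance inner_normal (k : Type*) [Field k] : (inner k).Normal where
  conj_mem := by
    rintro Φ ⟨a⟩ Ψ
    have h : functor Ψ⁻¹ ⋙ functor Ψ = 𝟭 _ := congrArg Cat.Hom.toFunctor Ψ.inv_hom_id
    exact ⟨(Functor.isoWhiskerLeft (functor Ψ⁻¹)
      ((Functor.isoWhiskerRight a (functor Ψ)).trans (Functor.leftUnitor _))).trans (eqToIso h)⟩

/-- The automorphism `Φ` preserves all objects, acts on morphisms `ψ : D ⟶ F` by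
`Φ(ψ) = s_F ∘ ψ ∘ s_D⁻¹`, and the bijections `s_F` fix the free generators. The `eqToHom`s only
identify `Φ(D)` with `D` and `Φ(F)` with `F`. -/
structure IsInducedBy {k : Type*} [Field k] (Φ : Autos k)
    (s : ∀ A : FreeCommAlgCat k, A.Carrier ≃ A.Carrier) : Prop where
  obj_eq : ∀ A : FreeCommAlgCat k, (functor Φ).obj A = A
  map_eq : ∀ {D F : FreeCommAlgCat k} (ψ : D ⟶ F) (d : D.Carrier),
    toAlgHom (eqToHom (obj_eq D).symm ≫ (functor Φ).map ψ ≫ eqToHom (obj_eq F)) d =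
      s F (toAlgHom ψ ((s D).symm d))
  map_gen : ∀ (A : FreeCommAlgCat k) (x : A.gens),
    s A (FreeCommNAAlgebra.gen k x) = FreeCommNAAlgebra.gen k x

/-- Strongly stable automorphisms. -/
def IsStronglyStable {k : Type*} [Field k] (Φ : Autos k) : Prop :=
  ∃ s : ∀ A : FreeCommAlgCat k, A.Carrier ≃ A.Carrier, IsInducedBy Φ s

/-- The bijection `s` is an isomorphism from `F` onto the algebra `F*` with the same elements and
the same addition, in which the multiplication by the scalar `c` is `f ↦ φ(c) f` and the product
of `f` and `g` is `α (f g)`. -/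
structure IsTwistIso {k : Type*} [Field k] (φ : RingAut k) (α : kˣ) {A : FreeCommAlgCat k}
    (s : A.Carrier ≃ A.Carrier) : Prop where
  map_add : ∀ f g : A.Carrier, s (f + g) = s f + s g
  map_smul : ∀ (c : k) (f : A.Carrier), s (c • f) = φ c • s f
  map_mul : ∀ f g : A.Carrier, s (f * g) = (α : k) • (s f * s g)

/-- The strongly stable automorphism `Φ` comes from twisting the scalars by `φ` and rescaling the
multiplication by `α`. -/
def IsTwist {k : Type*} [Field k] (Φ : Autos k) (φ : RingAut k) (α : kˣ) : Prop :=
  ∃ s : ∀ A : FreeCommAlgCat k, A.Carrier ≃ A.Carrier,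
    IsInducedBy Φ s ∧ ∀ A, IsTwistIso φ α (s A)

end FreeCommAlgCat

/-! An element of `F` is a morphism from the free algebra on one generator `x` to `F`, so an
automorphism `Φ` fixing `F(x)` up to isomorphism permutes elements. It does fix `F(x)`: this is a
retract of every object with nonzero identity, while a retract of `F(x)` has at most one generator
(compare linear parts). As every object is free on points from `F(x)`, correcting `Φ` by
isomorphisms makes it strongly stable (`exists_isInducedBy_of_autos`).

The bijections `s` of a strongly stable automorphism commute with substitution (`apply_point`,
`apply_pair`), so they are governed by three values. First, `s(cx)` generates `F(x)`, and a
generator of `F(x)` is a multiple of `x`: if its longest monomial `m₀` had length at least 2, a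
product altered only at `m₀` would kill it but not `x`. So `s(cx) = φ(c)x`. Next, `s(x+y)` and
`s(xy)` inherit the homogeneity of `x+y` and `xy`, and powers of 2 detect degrees in characteristic
zero; thus they are `ax+by` and `αxy`, and substituting 0 gives `a = b = 1`. Hence `φ` is a field
automorphism and `s` has type `(φ, α)` (`exists_isTwistIso`). Conversely, each pair is realised by
multiplying a monomial of length `n` by `α^(n-1)` and applying `φ` to coefficients.

Type `(1, α)` is inner because `f ↦ α s(f)` is a natural isomorphism. Conversely, an isomorphism of
a twist with the identity is `x ↦ ax` on `F(x)`, and naturality at `x ↦ cx` forces `φ(c) = c`. -/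

/-! ### Monomials and their weights -/

namespace FreeCommMagma

variable {X : Type*}

/-- The generator of the free commutative magma attached to `x`. -/
def of (x : X) : FreeCommMagma X := ((FreeMagma.of x : FreeMagma X) : FreeCommMagma X)

theorem induction {p : FreeCommMagma X → Prop} (hof : ∀ x, p (of x))
    (hmul : ∀ a b, p a → p b → p (a * b)) (a : FreeCommMagma X) : p a := by
  induction a using Con.induction_on with
  | H a =>
    induction a using FreeMagma.recOnMul with
    | ih1 x => exact hof x
    | ih2 a b ha hb => exact hmul _ _ ha hb

/-- The magma homomorphism into a commutative magma extending a map on the generators. -/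
def lift {N : Type*} [CommMagma N] (f : X → N) : FreeCommMagma X →ₙ* N where
  toFun a := Con.liftOn a (FreeMagma.lift f) fun a b h => by
    have hle : freeCommMagmaCon X ≤ Con.ker (FreeMagma.lift f) := by
      refine Con.conGen_le.2 ?_
      rintro _ _ ⟨u, v, rfl, rfl⟩
      simp [Con.ker_rel, mul_comm]
    exact hle h
  map_mul' a b := by
    induction a using Con.induction_on with
    | H a =>
      induction b using Con.induction_on with
      | H b => exact map_mul (FreeMagma.lift f) a b

@[simp] theorem lift_of {N : Type*} [CommMagma N] (f : X → N) (x : X) : lift f (of x) = f x := rfl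

/-- The weight of a monomial, given weights of the generators. -/
def weight (w : X → ℕ) (m : FreeCommMagma X) : ℕ :=
  (lift (fun x => Multiplicative.ofAdd (w x)) m).toAdd

@[simp] theorem weight_of (w : X → ℕ) (x : X) : weight w (of x) = w x := rfl

@[simp] theorem weight_mul (w : X → ℕ) (a b : FreeCommMagma X) :
    weight w (a * b) = weight w a + weight w b := by
  simp [weight, map_mul, toAdd_mul]

/-- The number of factors of a monomial. -/
abbrev length (m : FreeCommMagma X) : ℕ := weight (fun _ => 1) m

theorem length_pos (m : FreeCommMagma X) : 0 < length m := by
  induction m using induction with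
  | hof x => simp [length]
  | hmul a b ha hb => simp only [length, weight_mul] at *; omega

theorem eq_of_or_eq_mul (m : FreeCommMagma X) :
    (∃ x, m = of x) ∨ ∃ a b, m = a * b := by
  induction m using induction with
  | hof x => exact Or.inl ⟨x, rfl⟩
  | hmul a b _ _ => exact Or.inr ⟨a, b, rfl⟩

theorem exists_eq_of_of_length_eq_one {m : FreeCommMagma X} (h : length m = 1) :
    ∃ x, m = of x := by
  rcases eq_of_or_eq_mul m with h' | ⟨a, b, rfl⟩
  · exact h'
  · have ha := length_pos a
    have hb := length_pos b
    simp only [length, weight_mul] at *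
    omega

theorem of_injective : Function.Injective (of : X → FreeCommMagma X) := by
  classical
  intro x y h
  have := congrArg (weight (fun z => if z = x then 1 else 0)) h
  by_contra hne
  simp [Ne.symm hne] at this

theorem lift_pow_weight {k : Type*} [CommMonoid k] (c : k) (w : X → ℕ) (m : FreeCommMagma X) :
    lift (fun x => c ^ w x) m = c ^ weight w m := by
  induction m using induction with
  | hof x => simp
  | hmul a b ha hb => rw [map_mul, weight_mul, pow_add, ha, hb]

end FreeCommMagma

/-! ### Homogeneous elements, and generators of the free algebra in one variable -/

namespace FreeCommNAAlgebra

open FreeCommMagma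

variable {k : Type*} [Field k] {X : Type*}

noncomputable instance : NonUnitalNonAssocCommRing (FreeCommNAAlgebra k X) :=
  { (inferInstance : NonUnitalNonAssocRing (FreeCommNAAlgebra k X)) with
    mul_comm := mul_comm' k }

theorem gen_eq_single (x : X) : gen k x = MonoidAlgebra.single (of x) 1 := rfl

theorem gen_ne_zero (x : X) : gen k x ≠ 0 := by
  simp [gen_eq_single]

section lift

variable {A : Type*} [NonUnitalNonAssocCommRing A] [Module k A] [IsScalarTower k A A]
  [SMulCommClass k A A]

/-- The algebra homomorphism extending a map on the generators. -/
noncomputable def lift (f : X → A) : FreeCommNAAlgebra k X →ₙₐ[k] A :=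
  (existsUnique_lift k f).choose

@[simp] theorem lift_gen (f : X → A) (x : X) : lift f (gen k x) = f x :=
  (existsUnique_lift k f).choose_spec.1 x

theorem hom_ext {F G : FreeCommNAAlgebra k X →ₙₐ[k] A} (h : ∀ x, F (gen k x) = G (gen k x)) :
    F = G :=
  (existsUnique_lift k fun x => G (gen k x)).unique h fun _ => rfl

theorem lift_eq {f : X → A} {G : FreeCommNAAlgebra k X →ₙₐ[k] A}
    (h : ∀ x, G (gen k x) = f x) : G = lift f :=
  hom_ext fun x => by rw [h, lift_gen]

end lift

theorem single_mul' (a b : FreeCommMagma X) :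
    (MonoidAlgebra.single (a * b) 1 : FreeCommNAAlgebra k X) =
      MonoidAlgebra.single a 1 * MonoidAlgebra.single b 1 := by
  rw [MonoidAlgebra.single_mul_single, mul_one]

theorem single_eq_smul (a : FreeCommMagma X) (r : k) :
    (MonoidAlgebra.single a r : FreeCommNAAlgebra k X) = r • MonoidAlgebra.single a 1 := by
  simp

theorem lift_smul_gen_single (a : X → k) (m : FreeCommMagma X) :
    lift (fun x => a x • gen k x) (MonoidAlgebra.single m 1 : FreeCommNAAlgebra k X) =
      FreeCommMagma.lift a m • MonoidAlgebra.single m 1 := by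
  induction m using FreeCommMagma.induction with
  | hof x => rw [← gen_eq_single, lift_gen, FreeCommMagma.lift_of]
  | hmul u v hu hv =>
    rw [single_mul', map_mul, hu, hv, map_mul, smul_mul_smul_comm]

theorem coeff_lift_smul_gen (a : X → k) (f : FreeCommNAAlgebra k X) (m : FreeCommMagma X) :
    (lift (fun x => a x • gen k x) f).coeff m = FreeCommMagma.lift a m * f.coeff m := by
  classical
  induction f using MonoidAlgebra.induction_linear with
  | zero => simp
  | add f g hf hg => rw [map_add]; simp [hf, hg, mul_add]
  | single u r =>
    rw [single_eq_smul, map_smul, lift_smul_gen_single]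
    simp only [MonoidAlgebra.coeff_smul, MonoidAlgebra.coeff_single, Finsupp.smul_apply,
      Finsupp.single_apply, smul_eq_mul]
    split_ifs with h
    · subst h; ring
    · ring

/-- An element on which rescaling the generators by `2 ^ w` acts as `2 ^ n` is homogeneous. -/
theorem weight_eq_of_lift_eq [CharZero k] (w : X → ℕ) (n : ℕ) {f : FreeCommNAAlgebra k X}
    (h : lift (fun x => (2 : k) ^ w x • gen k x) f = (2 : k) ^ n • f) {m : FreeCommMagma X}
    (hm : f.coeff m ≠ 0) : weight w m = n := by
  have h1 := coeff_lift_smul_gen (fun x => (2 : k) ^ w x) f m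
  rw [h, lift_pow_weight] at h1
  simp only [MonoidAlgebra.coeff_smul, Finsupp.smul_apply, smul_eq_mul] at h1
  have h2 := mul_right_cancel₀ hm h1
  -- Characteristic zero brings the equality back to ℕ, where powers of 2 determine their exponents.
  have h3 : (2 : ℕ) ^ n = 2 ^ weight w m := by exact_mod_cast h2
  exact (Nat.pow_right_injective le_rfl h3).symm

/-- An element all of whose monomials are equal to `m₀`. -/
theorem eq_smul_single {f : FreeCommNAAlgebra k X} {m₀ : FreeCommMagma X}
    (h : ∀ m, f.coeff m ≠ 0 → m = m₀) : f = f.coeff m₀ • MonoidAlgebra.single m₀ 1 := by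
  classical
  ext m
  simp only [MonoidAlgebra.coeff_smul, MonoidAlgebra.coeff_single, Finsupp.smul_apply,
      Finsupp.single_apply, smul_eq_mul]
  split_ifs with h'
  · simp [h']
  · by_contra h2
    exact h' (h m (by simpa using h2)).symm

/-- The free commutative algebra with the product `f ∘ g = fg + c v`, where `c` is the
coefficient of `m₀` in `fg`. -/
def Perturbed (_ : FreeCommMagma X) (_ : FreeCommNAAlgebra k X) : Type _ :=
  FreeCommNAAlgebra k X

namespace Perturbed

variable (m₀ : FreeCommMagma X) (v : FreeCommNAAlgebra k X)

noncomputable instance : AddCommGroup (Perturbed m₀ v) :=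
  inferInstanceAs (AddCommGroup (FreeCommNAAlgebra k X))

noncomputable instance : Module k (Perturbed m₀ v) :=
  inferInstanceAs (Module k (FreeCommNAAlgebra k X))

/-- The identity map. -/
noncomputable def equiv : FreeCommNAAlgebra k X ≃ₗ[k] Perturbed m₀ v := LinearEquiv.refl k _

/-- The bilinear product. -/
noncomputable def mulAux (f g : FreeCommNAAlgebra k X) : FreeCommNAAlgebra k X :=
  f * g + (f * g).coeff m₀ • v

noncomputable instance : Mul (Perturbed m₀ v) :=
  ⟨fun f g => equiv m₀ v (mulAux m₀ v ((equiv m₀ v).symm f) ((equiv m₀ v).symm g))⟩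

theorem equiv_mul (f g : FreeCommNAAlgebra k X) :
    equiv m₀ v f * equiv m₀ v g = equiv m₀ v (f * g + (f * g).coeff m₀ • v) := rfl

@[elab_as_elim]
theorem induction {p : Perturbed m₀ v → Prop} (h : ∀ g, p (equiv m₀ v g)) (f : Perturbed m₀ v) :
    p f :=
  h f

noncomputable instance : NonUnitalNonAssocCommRing (Perturbed m₀ v) :=
  { (inferInstance : AddCommGroup (Perturbed m₀ v)),
    (inferInstance : Mul (Perturbed m₀ v)) with
    left_distrib := by
      intro a b c
      induction a using Perturbed.induction with | _ a
      induction b using Perturbed.induction with | _ b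
      induction c using Perturbed.induction with | _ c
      rw [← map_add, equiv_mul, equiv_mul, equiv_mul, ← map_add, mul_add]
      congr 1
      simp only [MonoidAlgebra.coeff_add, Finsupp.add_apply, add_smul]
      abel
    right_distrib := by
      intro a b c
      induction a using Perturbed.induction with | _ a
      induction b using Perturbed.induction with | _ b
      induction c using Perturbed.induction with | _ c
      rw [← map_add, equiv_mul, equiv_mul, equiv_mul, ← map_add, add_mul]
      congr 1
      simp only [MonoidAlgebra.coeff_add, Finsupp.add_apply, add_smul]
      abel
    zero_mul := by
      intro a
      induction a using Perturbed.induction with | _ a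
      rw [← map_zero (equiv m₀ v), equiv_mul]
      simp
    mul_zero := by
      intro a
      induction a using Perturbed.induction with | _ a
      rw [← map_zero (equiv m₀ v), equiv_mul]
      simp
    mul_comm := by
      intro a b
      induction a using Perturbed.induction with | _ a
      induction b using Perturbed.induction with | _ b
      rw [equiv_mul, equiv_mul, mul_comm' k a b] }

instance : IsScalarTower k (Perturbed m₀ v) (Perturbed m₀ v) where
  smul_assoc c a b := by
    induction a using Perturbed.induction with | _ a
    induction b using Perturbed.induction with | _ b
    rw [smul_eq_mul, smul_eq_mul, ← map_smul, equiv_mul, equiv_mul, ← map_smul]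
    congr 1
    simp [smul_mul_assoc, smul_add, mul_smul]

instance : SMulCommClass k (Perturbed m₀ v) (Perturbed m₀ v) where
  smul_comm c a b := by
    simp only [smul_eq_mul]
    rw [_root_.mul_comm a (c • b), smul_mul_assoc, _root_.mul_comm b a]

/-- The algebra homomorphism that is the identity on generators. -/
noncomputable def eval : FreeCommNAAlgebra k X →ₙₐ[k] Perturbed m₀ v :=
  lift fun x => equiv m₀ v (gen k x)

theorem coeff_single_ne {m m₀ : FreeCommMagma X} (h : m ≠ m₀) :
    (MonoidAlgebra.single m 1 : FreeCommNAAlgebra k X).coeff m₀ = 0 := by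
  simp [Ne.symm h]

/-- Proper factors of `m` are shorter than `m₀`, so the coefficient of `m₀` vanishes in every
product formed and no correction occurs. -/
theorem eval_single_of_length_lt {m : FreeCommMagma X} (hm : length m ≤ length m₀) (hne : m ≠ m₀) :
    eval m₀ v (MonoidAlgebra.single m 1) = equiv m₀ v (MonoidAlgebra.single m 1) := by
  induction m using FreeCommMagma.induction with
  | hof x => rw [← gen_eq_single]; exact lift_gen _ x
  | hmul a b ha hb =>
    have h1 := length_pos a
    have h2 := length_pos b
    have h3 : length (a * b) = length a + length b := weight_mul _ _ _
    rw [single_mul', map_mul, ha (by omega) (by rintro rfl; omega),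
      hb (by omega) (by rintro rfl; omega), equiv_mul, ← single_mul', coeff_single_ne hne]
    simp

/-- Both factors of `m₀` evaluate to themselves, so the correction `v` enters exactly once, at the
last product. -/
theorem eval_single_self (hm : 2 ≤ length m₀) :
    eval m₀ v (MonoidAlgebra.single m₀ 1) = equiv m₀ v (MonoidAlgebra.single m₀ 1 + v) := by
  rcases eq_of_or_eq_mul m₀ with ⟨x, hx⟩ | ⟨a, b, hab⟩
  · rw [hx] at hm; simp [length] at hm
  · have h1 := length_pos a
    have h2 := length_pos b
    have h3 : length m₀ = length a + length b := by rw [hab]; exact weight_mul _ _ _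
    have e : (MonoidAlgebra.single m₀ 1 : FreeCommNAAlgebra k X) =
      MonoidAlgebra.single a 1 * MonoidAlgebra.single b 1 := by rw [← single_mul', hab]
    rw [e, map_mul, eval_single_of_length_lt m₀ v (by omega) (by rintro rfl; omega),
      eval_single_of_length_lt m₀ v (by omega) (by rintro rfl; omega), equiv_mul, ← e]
    simp

theorem eval_eq (hm : 2 ≤ length m₀) {f : FreeCommNAAlgebra k X}
    (hf : ∀ m, f.coeff m ≠ 0 → length m ≤ length m₀) :
    eval m₀ v f = equiv m₀ v (f + f.coeff m₀ • v) := by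
  classical
  have hsum : f = ∑ m ∈ f.coeff.support, f.coeff m • MonoidAlgebra.single m (1 : k) := by
    apply MonoidAlgebra.coeff_injective
    conv_lhs => rw [← f.coeff.sum_single]
    simp [Finsupp.sum]
  have key : ∀ m, length m ≤ length m₀ → eval m₀ v (MonoidAlgebra.single m 1) =
      equiv m₀ v (MonoidAlgebra.single m 1 + (if m = m₀ then (1 : k) else 0) • v) := by
    intro m h
    split_ifs with h'
    · subst h'; rw [eval_single_self _ _ hm, one_smul]
    · rw [eval_single_of_length_lt _ _ h h', zero_smul, add_zero]
  conv_lhs => rw [hsum]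
  rw [map_sum, Finset.sum_congr rfl fun m hm' => by
    rw [map_smul, key m (hf m (by simpa using hm')), ← map_smul], ← map_sum]
  congr 1
  simp only [smul_add, Finset.sum_add_distrib]
  rw [← hsum]
  congr 1
  simp only [ite_smul, one_smul, zero_smul, smul_ite, smul_zero, Finset.sum_ite_eq']
  split_ifs with h
  · rfl
  · simp at h; simp [h]

end Perturbed

/-- An element that generates the free algebra on one generator is a multiple of the generator. -/
theorem length_eq_one_of_lift_eq_gen [Unique X] {u v : FreeCommNAAlgebra k X}
    (h : lift (fun _ => v) u = gen k default) {m : FreeCommMagma X} (hm : v.coeff m ≠ 0) :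
    length m = 1 := by
  classical
  by_contra hne
  obtain ⟨m₀, hm₀, hmax⟩ := v.coeff.support.exists_max_image length ⟨m, by simpa using hm⟩
  have hc : v.coeff m₀ ≠ 0 := by simpa using hm₀
  have h2 : 2 ≤ length m₀ := by
    have := hmax m (by simpa using hm)
    have := length_pos m
    omega
  -- With `c` the coefficient of `m₀`, this choice makes `v` evaluate to `v + c • w = 0`.
  set w : FreeCommNAAlgebra k X := -(v.coeff m₀)⁻¹ • v with hw
  have hv : Perturbed.eval m₀ w v = 0 := by
    rw [Perturbed.eval_eq m₀ w h2 fun m hm => hmax m (by simpa using hm), hw, smul_smul, mul_neg,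
      mul_inv_cancel₀ hc, neg_one_smul, add_neg_cancel, map_zero]
  -- Evaluation therefore kills everything obtained by substituting `v`, including the generator,
  -- which it should fix.
  have hz : (Perturbed.eval m₀ w).comp (lift fun _ : X => v) = 0 :=
    hom_ext fun x => by
      rw [NonUnitalAlgHom.comp_apply, lift_gen, hv]; rfl
  have h0 : Perturbed.eval m₀ w (gen k default) = 0 := by
    rw [← h, ← NonUnitalAlgHom.comp_apply, hz]; rfl
  have h1 : Perturbed.eval m₀ w (gen k default) = Perturbed.equiv m₀ w (gen k default) :=
    lift_gen _ _
  rw [h1] at h0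
  exact gen_ne_zero default ((map_eq_zero_iff _ (Perturbed.equiv m₀ w).injective).1 h0)

theorem eq_smul_gen_of_lift_eq_gen [Unique X] {u v : FreeCommNAAlgebra k X}
    (h : lift (fun _ => v) u = gen k default) : ∃ a : k, v = a • gen k default :=
  ⟨_, eq_smul_single fun m hm => by
    obtain ⟨x, rfl⟩ := exists_eq_of_of_length_eq_one (length_eq_one_of_lift_eq_gen h hm)
    rw [Unique.eq_default x]; rfl⟩

end FreeCommNAAlgebra

/-! ### Compatible families of bijections are twists -/

namespace FreeCommAlgCat

open FreeCommNAAlgebra FreeCommMagma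

variable {k : Type*} [Field k]

/-- The object with one free generator. -/
abbrev one (k : Type*) [Field k] : FreeCommAlgCat k := ⟨{0}⟩

/-- The object with two free generators. -/
abbrev two (k : Type*) [Field k] : FreeCommAlgCat k := ⟨{0, 1}⟩

instance : Unique (one k).gens := inferInstanceAs (Unique ({0} : Finset ℕ))

/-- The free generator of the object with one generator. -/
noncomputable abbrev oneGen (k : Type*) [Field k] : (one k).Carrier := gen k default

/-- The first free generator of the object with two generators. -/
abbrev fst (k : Type*) [Field k] : (two k).gens := ⟨0, by simp⟩

/-- The second free generator of the object with two generators. -/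
abbrev snd (k : Type*) [Field k] : (two k).gens := ⟨1, by simp⟩

theorem eq_fst_or_eq_snd (x : (two k).gens) : x = fst k ∨ x = snd k := by
  obtain ⟨x, hx⟩ := x
  simpa [Subtype.ext_iff] using hx

theorem fst_ne_snd : fst k ≠ snd k := by simp [Subtype.ext_iff]

/-- Families of bijections `s` such that `s_F ∘ ψ ∘ s_D⁻¹` is a homomorphism for every
homomorphism `ψ : D ⟶ F`. -/
def Compatible (s : ∀ A : FreeCommAlgCat k, A.Carrier ≃ A.Carrier) : Prop :=
  ∀ ⦃D F : FreeCommAlgCat k⦄ (ψ : D.Carrier →ₙₐ[k] F.Carrier),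
    ∃ χ : D.Carrier →ₙₐ[k] F.Carrier, ∀ d, χ (s D d) = s F (ψ d)

/-- The family of bijections fixes the free generators. -/
def FixesGens (s : ∀ A : FreeCommAlgCat k, A.Carrier ≃ A.Carrier) : Prop :=
  ∀ (A : FreeCommAlgCat k) (x : A.gens), s A (gen k x) = gen k x

theorem FixesGens.symm {s : ∀ A : FreeCommAlgCat k, A.Carrier ≃ A.Carrier} (h : FixesGens s) :
    FixesGens fun A => (s A).symm := fun A x => by
  rw [Equiv.symm_apply_eq, h]

/-- The homomorphism from the free algebra on two generators with given values. -/
noncomputable def pair {F : FreeCommAlgCat k} (f g : F.Carrier) :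
    (two k).Carrier →ₙₐ[k] F.Carrier :=
  lift fun x => if x = fst k then f else g

@[simp] theorem pair_fst {F : FreeCommAlgCat k} (f g : F.Carrier) :
    pair f g (gen k (fst k)) = f := by simp [pair]

@[simp] theorem pair_snd {F : FreeCommAlgCat k} (f g : F.Carrier) :
    pair f g (gen k (snd k)) = g := by simp [pair]

theorem pair_smul_pow (a b : ℕ) :
    pair ((2 : k) ^ a • gen k (fst k)) ((2 : k) ^ b • gen k (snd k)) =
      FreeCommNAAlgebra.lift fun x => (2 : k) ^ (if x = fst k then a else b) • gen k x := by
  unfold pair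
  congr 1
  ext1 x
  rcases eq_fst_or_eq_snd x with rfl | rfl
  · simp
  · simp

/-- The homomorphism from the free algebra on one generator with given value. -/
noncomputable def point {F : FreeCommAlgCat k} (f : F.Carrier) :
    (one k).Carrier →ₙₐ[k] F.Carrier :=
  lift fun _ => f

@[simp] theorem point_gen {F : FreeCommAlgCat k} (f : F.Carrier) (x : (one k).gens) :
    point f (gen k x) = f := lift_gen _ _

theorem hom_ext_two {F : FreeCommAlgCat k} {χ χ' : (two k).Carrier →ₙₐ[k] F.Carrier}
    (h : χ (gen k (fst k)) = χ' (gen k (fst k))) (h' : χ (gen k (snd k)) = χ' (gen k (snd k))) :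
    χ = χ' :=
  hom_ext fun x => by
    rcases eq_fst_or_eq_snd x with rfl | rfl
    · exact h
    · exact h'

section Compatible

variable {s : ∀ A : FreeCommAlgCat k, A.Carrier ≃ A.Carrier}

/-- The conjugate of `point f` is a homomorphism sending the fixed generator to `s F f`, hence
equals `point (s F f)`. -/
theorem apply_point (hs : Compatible s) (hg : FixesGens s) {F : FreeCommAlgCat k} (f : F.Carrier)
    (d : (one k).Carrier) : s F (point f d) = point (s F f) (s (one k) d) := by
  obtain ⟨χ, hχ⟩ := hs (point f)
  rw [← hχ]
  congr 1
  refine hom_ext fun x => ?_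
  rw [← hg, hχ, point_gen, hg, point_gen]

/-- The value of `s` on `d` decides how `s` treats the binary operation `d` in every algebra. -/
theorem apply_pair (hs : Compatible s) (hg : FixesGens s) {F : FreeCommAlgCat k} (f g : F.Carrier)
    (d : (two k).Carrier) : s F (pair f g d) = pair (s F f) (s F g) (s (two k) d) := by
  obtain ⟨χ, hχ⟩ := hs (pair f g)
  rw [← hχ]
  congr 1
  refine hom_ext_two ?_ ?_
  · rw [← hg, hχ, pair_fst, hg, pair_fst]
  · rw [← hg, hχ, pair_snd, hg, pair_snd]

/-- The algebra on no generators is zero, so `s` fixes its only element; a homomorphism from it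
carries this to `A`. -/
theorem apply_zero (hs : Compatible s) (A : FreeCommAlgCat k) : s A 0 = 0 := by
  let E : FreeCommAlgCat k := ⟨∅⟩
  obtain ⟨χ, hχ⟩ := hs (0 : E.Carrier →ₙₐ[k] A.Carrier)
  have h0 : s E 0 = 0 := by
    have : (NonUnitalAlgHom.id k E.Carrier) = 0 :=
      hom_ext fun x => absurd x.2 (Finset.notMem_empty _)
    have := DFunLike.congr_fun this (s E 0)
    simpa using this
  have := hχ 0
  rw [h0, map_zero] at this
  exact this.symm

theorem exists_apply_smul (hs : Compatible s) (hg : FixesGens s) :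
    ∃ q : k → k, ∀ (c : k) (A : FreeCommAlgCat k) (f : A.Carrier), s A (c • f) = q c • s A f := by
  have h1 : ∀ c : k, ∃ a : k, s (one k) (c • oneGen k) = a • oneGen k := by
    intro c
    rcases eq_or_ne c 0 with rfl | hc
    · exact ⟨0, by simp only [zero_smul, apply_zero hs]⟩
    -- Substituting `c • x` into `c⁻¹ • x` returns `x`; applying `s` shows that `s (c • x)`
    -- generates.
    · refine eq_smul_gen_of_lift_eq_gen (u := s (one k) (c⁻¹ • oneGen k)) ?_
      have := apply_point hs hg (c • oneGen k) (c⁻¹ • oneGen k)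
      rw [map_smul, point_gen, smul_smul, inv_mul_cancel₀ hc, one_smul, hg] at this
      exact this.symm
  choose q hq using h1
  refine ⟨q, fun c A f => ?_⟩
  have := apply_point hs hg f (c • oneGen k)
  rwa [map_smul (point f), point_gen, hq, map_smul (point _), point_gen] at this

theorem smul_gen_injective {A : FreeCommAlgCat k} (x : A.gens) {a b : k}
    (h : a • gen k x = b • gen k x) : a = b :=
  smul_left_injective k (gen_ne_zero x) h

theorem eq_add_of_length [CharZero k] {f : (two k).Carrier}
    (h : pair ((2 : k) • gen k (fst k)) ((2 : k) • gen k (snd k)) f = (2 : k) • f) :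
    ∃ a b : k, f = a • gen k (fst k) + b • gen k (snd k) := by
  classical
  refine ⟨f.coeff (of (fst k)), f.coeff (of (snd k)), ?_⟩
  have h' : FreeCommNAAlgebra.lift (fun x => (2 : k) ^ 1 • gen k x) f = (2 : k) ^ 1 • f := by
    have := pair_smul_pow (k := k) 1 1
    simp only [ite_self, pow_one] at this ⊢
    rw [← this, h]
  have hl := fun m => weight_eq_of_lift_eq (fun _ => 1) 1 h' (m := m)
  have hne : (of (snd k) : FreeCommMagma (two k).gens) ≠ of (fst k) :=
    fun h => fst_ne_snd (of_injective h).symm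
  ext m
  simp only [gen_eq_single, MonoidAlgebra.coeff_add, MonoidAlgebra.coeff_smul,
    MonoidAlgebra.coeff_single, Finsupp.add_apply, Finsupp.smul_apply, Finsupp.single_apply,
    smul_eq_mul, mul_ite, mul_one, mul_zero]
  by_cases hm : f.coeff m = 0
  · split_ifs with h1 h2 h2
    · exact absurd (h2.trans h1.symm) hne
    · subst h1; simp
    · subst h2; simp
    · simp [hm]
  · obtain ⟨x, rfl⟩ := exists_eq_of_of_length_eq_one (hl m hm)
    rcases eq_fst_or_eq_snd x with rfl | rfl
    · simp [hne]
    · simp [hne.symm]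

/-- The two weights add up to the length, so `m` is a product of two generators, and commutativity
leaves one such product. -/
theorem eq_mul_of_weight_eq_one {m : FreeCommMagma (two k).gens}
    (h : weight (fun x => if x = fst k then 1 else 0) m = 1)
    (h' : weight (fun x => if x = fst k then 0 else 1) m = 1) : m = of (fst k) * of (snd k) := by
  have hl : ∀ m : FreeCommMagma (two k).gens, length m =
      weight (fun x => if x = fst k then 1 else 0) m +
        weight (fun x => if x = fst k then 0 else 1) m := by
    intro m
    induction m using FreeCommMagma.induction with
    | hof x => simp only [length, weight_of]; split_ifs <;> rfl
    | hmul a b ha hb => simp only [length, weight_mul] at *; omega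
  rcases eq_of_or_eq_mul m with ⟨x, rfl⟩ | ⟨a, b, rfl⟩
  · have := hl (of x)
    simp [length, h, h'] at this
  · have h1 := hl (a * b)
    have ha := length_pos a
    have hb := length_pos b
    have h2 : length (a * b) = length a + length b := weight_mul _ _ _
    obtain ⟨x, rfl⟩ := exists_eq_of_of_length_eq_one (m := a) (by omega)
    obtain ⟨y, rfl⟩ := exists_eq_of_of_length_eq_one (m := b) (by omega)
    rcases eq_fst_or_eq_snd x with rfl | rfl <;> rcases eq_fst_or_eq_snd y with rfl | rfl
    · simp at h
    · rfl
    · exact magma_mul_comm _ _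
    · simp at h

theorem eq_smul_mul [CharZero k] {f : (two k).Carrier}
    (h : pair ((2 : k) • gen k (fst k)) (gen k (snd k)) f = (2 : k) • f)
    (h' : pair (gen k (fst k)) ((2 : k) • gen k (snd k)) f = (2 : k) • f) :
    ∃ a : k, f = a • (gen k (fst k) * gen k (snd k)) := by
  have e1 := pair_smul_pow (k := k) 1 0
  have e2 := pair_smul_pow (k := k) 0 1
  simp only [pow_one, pow_zero, one_smul] at e1 e2
  refine ⟨f.coeff (of (fst k) * of (snd k)), ?_⟩
  rw [gen_eq_single, gen_eq_single, ← single_mul']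
  refine eq_smul_single fun m hm => eq_mul_of_weight_eq_one ?_ ?_
  · exact weight_eq_of_lift_eq _ 1 (by rw [← e1, h, pow_one]) hm
  · exact weight_eq_of_lift_eq _ 1 (by rw [← e2, h', pow_one]) hm

theorem gen_mul_gen_ne_zero {X : Type*} (x y : X) : gen k x * gen k y ≠ 0 := by
  rw [gen_eq_single, gen_eq_single, ← single_mul']
  simp

/-- Compatible families of bijections fixing the generators are twists. -/
theorem exists_isTwistIso [CharZero k] (hs : Compatible s) (hs' : Compatible fun A => (s A).symm)
    (hg : FixesGens s) : ∃ (φ : RingAut k) (α : kˣ), ∀ A, IsTwistIso φ α (s A) := by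
  obtain ⟨q, hq⟩ := exists_apply_smul hs hg
  obtain ⟨q', hq'⟩ := exists_apply_smul hs' hg.symm
  have hl : ∀ c, q' (q c) = c := fun c => by
    refine smul_gen_injective (A := one k) default ?_
    rw [← (s (one k)).symm_apply_apply (c • gen k default), hq, hg, hq', hg.symm]
  have hr : ∀ c, q (q' c) = c := fun c => by
    refine smul_gen_injective (A := one k) default ?_
    rw [← (s (one k)).apply_symm_apply (c • gen k default), hq', hg.symm, hq, hg]
  obtain ⟨a, b, hab⟩ : ∃ a b : k, s (two k) (gen k (fst k) + gen k (snd k)) =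
      a • gen k (fst k) + b • gen k (snd k) := by
    -- Rescaling by `q' 2` becomes rescaling by `q (q' 2) = 2` after conjugation; `q 2 = 2` is not
    -- yet known.
    refine eq_add_of_length ?_
    have := apply_pair hs hg (q' 2 • gen k (fst k)) (q' 2 • gen k (snd k))
      (gen k (fst k) + gen k (snd k))
    rw [map_add, pair_fst, pair_snd, ← smul_add, hq, hq, hq, hr, hg, hg] at this
    exact this.symm
  have hadd' : ∀ (A : FreeCommAlgCat k) (f g : A.Carrier),
      s A (f + g) = a • s A f + b • s A g := by
    intro A f g
    have := apply_pair hs hg f g (gen k (fst k) + gen k (snd k))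
    rwa [map_add (pair f g), pair_fst, pair_snd, hab, map_add (pair _ _), map_smul, map_smul,
      pair_fst, pair_snd] at this
  have ha : a = 1 := by
    refine smul_gen_injective (A := one k) default ?_
    have := hadd' (one k) (gen k default) 0
    rw [add_zero, apply_zero hs, hg, smul_zero, add_zero] at this
    rw [← this, one_smul]
  have hb : b = 1 := by
    refine smul_gen_injective (A := one k) default ?_
    have := hadd' (one k) 0 (gen k default)
    rw [zero_add, apply_zero hs, hg, smul_zero, zero_add] at this
    rw [← this, one_smul]
  have hadd : ∀ (A : FreeCommAlgCat k) (f g : A.Carrier), s A (f + g) = s A f + s A g := by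
    intro A f g
    rw [hadd', ha, hb, one_smul, one_smul]
  obtain ⟨α, hα⟩ : ∃ α : k, s (two k) (gen k (fst k) * gen k (snd k)) =
      α • (gen k (fst k) * gen k (snd k)) := by
    refine eq_smul_mul ?_ ?_
    · have := apply_pair hs hg (q' 2 • gen k (fst k)) (gen k (snd k))
        (gen k (fst k) * gen k (snd k))
      rw [map_mul, pair_fst, pair_snd, smul_mul_assoc, hq, hq, hr, hg, hg] at this
      exact this.symm
    · have := apply_pair hs hg (gen k (fst k)) (q' 2 • gen k (snd k))
        (gen k (fst k) * gen k (snd k))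
      rw [map_mul, pair_fst, pair_snd, mul_smul_comm, hq, hq, hr, hg, hg] at this
      exact this.symm
  have hα0 : α ≠ 0 := by
    rintro rfl
    rw [zero_smul, ← apply_zero hs] at hα
    exact gen_mul_gen_ne_zero _ _ ((s (two k)).injective hα)
  let φ : RingAut k :=
    { toFun := q
      invFun := q'
      left_inv := hl
      right_inv := hr
      map_mul' := fun c d => by
        refine smul_gen_injective (A := one k) default ?_
        have h1 := hq (c * d) (one k) (gen k default)
        rw [mul_smul, hq, hq, hg, smul_smul] at h1
        exact h1.symm
      map_add' := fun c d => by
        refine smul_gen_injective (A := one k) default ?_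
        have h1 := hq (c + d) (one k) (gen k default)
        rw [add_smul, hadd, hq, hq, hg, ← add_smul] at h1
        exact h1.symm }
  refine ⟨φ, Units.mk0 α hα0, fun A => ⟨hadd A, fun c f => hq c A f, fun f g => ?_⟩⟩
  have := apply_pair hs hg f g (gen k (fst k) * gen k (snd k))
  rwa [map_mul (pair f g), pair_fst, pair_snd, hα, map_smul, map_mul (pair _ _), pair_fst,
    pair_snd] at this

end Compatible

end FreeCommAlgCat

/-! ### Automorphisms given by conjugation -/

namespace FreeCommAlgCat

open FreeCommNAAlgebra FreeCommMagma

variable {k : Type*} [Field k]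

theorem toAlgHom_comp {A B C : FreeCommAlgCat k} (f : A ⟶ B) (g : B ⟶ C) (a : A.Carrier) :
    toAlgHom (f ≫ g) a = toAlgHom g (toAlgHom f a) := rfl

theorem toAlgHom_id (A : FreeCommAlgCat k) (a : A.Carrier) : toAlgHom (𝟙 A) a = a := rfl

theorem toAlgHom_ext {A B : FreeCommAlgCat k} {f g : A ⟶ B}
    (h : ∀ a, toAlgHom f a = toAlgHom g a) : f = g :=
  NonUnitalAlgHom.ext h

/-- An algebra homomorphism as a morphism of the category. -/
def ofAlgHom {A B : FreeCommAlgCat k} (f : A.Carrier →ₙₐ[k] B.Carrier) : A ⟶ B := f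

theorem toAlgHom_ofAlgHom {A B : FreeCommAlgCat k} (f : A.Carrier →ₙₐ[k] B.Carrier) :
    toAlgHom (ofAlgHom f) = f := rfl

theorem toAlgHom_ext_gen {A B : FreeCommAlgCat k} {f g : A ⟶ B}
    (h : ∀ x, toAlgHom f (gen k x) = toAlgHom g (gen k x)) : f = g :=
  hom_ext h

section conj

variable {s t : ∀ A : FreeCommAlgCat k, A.Carrier ≃ A.Carrier}

/-- The conjugate of a morphism by a compatible family of bijections. -/
noncomputable def conjMap (hs : Compatible s) {D F : FreeCommAlgCat k} (ψ : D ⟶ F) : D ⟶ F :=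
  ofAlgHom (hs (toAlgHom ψ)).choose

theorem conjMap_apply (hs : Compatible s) {D F : FreeCommAlgCat k} (ψ : D ⟶ F) (d : D.Carrier) :
    toAlgHom (conjMap hs ψ) (s D d) = s F (toAlgHom ψ d) :=
  (hs (toAlgHom ψ)).choose_spec d

/-- The functor that conjugates the morphisms by a compatible family of bijections. -/
noncomputable def conjFunctor (hs : Compatible s) : FreeCommAlgCat k ⥤ FreeCommAlgCat k where
  obj A := A
  map ψ := conjMap hs ψ
  map_id A := toAlgHom_ext fun a => by
    rw [← (s A).apply_symm_apply a, conjMap_apply]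
    rfl
  map_comp {A B C} f g := toAlgHom_ext fun a => by
    rw [← (s A).apply_symm_apply a, toAlgHom_comp, conjMap_apply, conjMap_apply, conjMap_apply,
      toAlgHom_comp]

theorem conjFunctor_comp_conjFunctor (hs : Compatible s) (ht : Compatible t)
    (h : ∀ A a, t A (s A a) = a) : conjFunctor hs ⋙ conjFunctor ht = 𝟭 _ := by
  refine CategoryTheory.Functor.ext (fun _ => rfl) fun D F ψ => ?_
  change conjMap ht (conjMap hs ψ) = ψ
  refine toAlgHom_ext fun d => ?_
  rw [← h D d, conjMap_apply, conjMap_apply, h, h]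

/-- The automorphism of the category that conjugates the morphisms by a family of bijections. -/
noncomputable def conjAuto (hs : Compatible s) (hs' : Compatible fun A => (s A).symm) :
    Autos k where
  hom := (conjFunctor hs).toCatHom
  inv := (conjFunctor hs').toCatHom
  hom_inv_id := congrArg Functor.toCatHom
    (conjFunctor_comp_conjFunctor hs hs' fun A a => (s A).symm_apply_apply a)
  inv_hom_id := congrArg Functor.toCatHom
    (conjFunctor_comp_conjFunctor hs' hs fun A a => (s A).apply_symm_apply a)

theorem isInducedBy_conjAuto (hs : Compatible s) (hs' : Compatible fun A => (s A).symm)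
    (hg : FixesGens s) : IsInducedBy (conjAuto hs hs') s where
  obj_eq _ := rfl
  map_eq {D F} ψ d := by
    have h := conjMap_apply hs ψ ((s D).symm d)
    rw [Equiv.apply_symm_apply] at h
    exact h
  map_gen := hg

theorem autos_ext {Φ Ψ : Autos k} (h : functor Φ = functor Ψ) : Φ = Ψ :=
  Iso.ext (Cat.Hom.ext h)

theorem functor_comp_inv (Φ : Autos k) : functor Φ ⋙ functor Φ⁻¹ = 𝟭 _ :=
  congrArg Cat.Hom.toFunctor Φ.hom_inv_id

theorem functor_inv_comp (Φ : Autos k) : functor Φ⁻¹ ⋙ functor Φ = 𝟭 _ :=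
  congrArg Cat.Hom.toFunctor Φ.inv_hom_id

/-- The equivalence of categories given by an automorphism. -/
noncomputable def equivalence (Φ : Autos k) : FreeCommAlgCat k ≌ FreeCommAlgCat k := Cat.equivOfIso Φ

instance (Φ : Autos k) : (functor Φ).IsEquivalence :=
  inferInstanceAs (equivalence Φ).functor.IsEquivalence

theorem IsInducedBy.compatible {Φ : Autos k} (h : IsInducedBy Φ s) : Compatible s := by
  intro D F ψ
  refine ⟨toAlgHom (eqToHom (h.obj_eq D).symm ≫ (functor Φ).map (ofAlgHom ψ) ≫
    eqToHom (h.obj_eq F)), fun d => ?_⟩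
  rw [h.map_eq, Equiv.symm_apply_apply]
  rfl

/-- Fullness of `Φ` writes any homomorphism as a conjugate, which can then be undone. -/
theorem IsInducedBy.compatible_symm {Φ : Autos k} (h : IsInducedBy Φ s) :
    Compatible fun A => (s A).symm := by
  intro D F ψ
  obtain ⟨χ, hχ⟩ := (functor Φ).map_surjective
    (eqToHom (h.obj_eq D) ≫ ofAlgHom ψ ≫ eqToHom (h.obj_eq F).symm)
  refine ⟨toAlgHom χ, fun d => ?_⟩
  have := h.map_eq χ d
  rw [hχ] at this
  simp only [Category.assoc, eqToHom_trans, eqToHom_refl, Category.comp_id,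
    eqToHom_trans_assoc, Category.id_comp] at this
  rw [Equiv.eq_symm_apply, ← this]
  rfl

theorem IsInducedBy.eq_conjAuto {Φ : Autos k} (h : IsInducedBy Φ s) :
    Φ = conjAuto h.compatible h.compatible_symm := by
  refine autos_ext (CategoryTheory.Functor.ext h.obj_eq fun D F ψ => ?_)
  have : eqToHom (h.obj_eq D).symm ≫ (functor Φ).map ψ ≫ eqToHom (h.obj_eq F) =
      conjMap h.compatible ψ :=
    toAlgHom_ext fun d => by
      rw [h.map_eq, ← conjMap_apply h.compatible, Equiv.apply_symm_apply]
  change (functor Φ).map ψ = eqToHom (h.obj_eq D) ≫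
    conjMap h.compatible ψ ≫ eqToHom (h.obj_eq F).symm
  rw [← this]
  simp

theorem IsInducedBy.unique {Φ Ψ : Autos k} (h : IsInducedBy Φ s) (h' : IsInducedBy Ψ s) :
    Φ = Ψ := by
  rw [h.eq_conjAuto, h'.eq_conjAuto]

/-- Since `s` fixes the generator, `s A f` is the value there of the image under `Φ` of the point
`f`, so `Φ` determines `s`. -/
theorem IsInducedBy.eq_family {Φ : Autos k} (h : IsInducedBy Φ s) (h' : IsInducedBy Φ t)
    (A : FreeCommAlgCat k) : s A = t A := by
  ext1 f
  have h1 := h.map_eq (ofAlgHom (point f)) (oneGen k)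
  have h2 := h'.map_eq (ofAlgHom (point f)) (oneGen k)
  rw [h1] at h2
  rwa [(Equiv.symm_apply_eq _).2 (h.map_gen _ _).symm,
    (Equiv.symm_apply_eq _).2 (h'.map_gen _ _).symm, toAlgHom_ofAlgHom, point_gen] at h2

theorem Compatible.comp (hs : Compatible s) (ht : Compatible t) :
    Compatible fun A => (t A).trans (s A) := by
  intro D F ψ
  obtain ⟨χ, hχ⟩ := ht ψ
  obtain ⟨ω, hω⟩ := hs χ
  exact ⟨ω, fun d => by simp [hω, hχ]⟩

theorem IsInducedBy.mul {Φ Ψ : Autos k} (h : IsInducedBy Φ s) (h' : IsInducedBy Ψ t) :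
    IsInducedBy (Φ * Ψ) fun A => (t A).trans (s A) := by
  have hc := h.compatible.comp h'.compatible
  have hc' : Compatible fun A => ((t A).trans (s A)).symm :=
    h'.compatible_symm.comp h.compatible_symm
  have : Φ * Ψ = conjAuto hc hc' := by
    rw [h.eq_conjAuto, h'.eq_conjAuto]
    refine autos_ext (CategoryTheory.Functor.ext (fun _ => rfl) fun D F ψ => ?_)
    change conjMap h.compatible (conjMap h'.compatible ψ) = conjMap hc ψ
    refine toAlgHom_ext fun d => ?_
    obtain ⟨d, rfl⟩ := ((t D).trans (s D)).surjective d
    rw [conjMap_apply hc ψ d, Equiv.trans_apply, conjMap_apply, conjMap_apply, Equiv.trans_apply]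
  rw [this]
  exact isInducedBy_conjAuto hc hc' fun A x => by simp [h.map_gen, h'.map_gen]

end conj

/-! ### Twists: existence, uniqueness, composition, innerness -/

section twist

/-- A homomorphism also respects the twisted operations, so its transport along `s` is again a
homomorphism. -/
theorem IsTwistIso.compatible {s : ∀ A : FreeCommAlgCat k, A.Carrier ≃ A.Carrier} {φ : RingAut k}
    {α : kˣ} (h : ∀ A, IsTwistIso φ α (s A)) : Compatible s := by
  have hsmul : ∀ (A : FreeCommAlgCat k) (c : k) (f : A.Carrier),
      c • s A f = s A (φ.symm c • f) := fun A c f => by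
    rw [(h A).map_smul, RingEquiv.apply_symm_apply]
  have hmul : ∀ (A : FreeCommAlgCat k) (f g : A.Carrier),
      s A f * s A g = s A (φ.symm (α⁻¹ : kˣ) • (f * g)) := fun A f g => by
    rw [← hsmul, (h A).map_mul, smul_smul, Units.inv_mul, one_smul]
  have hzero : ∀ A, s A 0 = 0 := fun A => by
    have := (h A).map_add 0 0
    rwa [add_zero, left_eq_add] at this
  intro D F ψ
  refine ⟨{ toFun := fun d => s F (ψ ((s D).symm d))
            map_smul' := fun c d => ?_
            map_zero' := ?_
            map_add' := fun d e => ?_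
            map_mul' := fun d e => ?_ }, fun d => ?_⟩
  · obtain ⟨d, rfl⟩ := (s D).surjective d
    rw [hsmul, Equiv.symm_apply_apply, Equiv.symm_apply_apply, _root_.map_smul ψ, ← hsmul]
    rfl
  · rw [(Equiv.symm_apply_eq _).2 (hzero D).symm, _root_.map_zero ψ, hzero]
  · obtain ⟨d, rfl⟩ := (s D).surjective d
    obtain ⟨e, rfl⟩ := (s D).surjective e
    rw [← (h D).map_add, Equiv.symm_apply_apply, Equiv.symm_apply_apply, Equiv.symm_apply_apply,
      _root_.map_add ψ, (h F).map_add]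
  · obtain ⟨d, rfl⟩ := (s D).surjective d
    obtain ⟨e, rfl⟩ := (s D).surjective e
    rw [hmul, Equiv.symm_apply_apply, Equiv.symm_apply_apply, Equiv.symm_apply_apply,
      _root_.map_smul ψ, _root_.map_mul ψ, ← hmul]
  · change s F (ψ ((s D).symm (s D d))) = _
    rw [Equiv.symm_apply_apply]

theorem IsTwistIso.symm {A : FreeCommAlgCat k} {s : A.Carrier ≃ A.Carrier} {φ : RingAut k}
    {α : kˣ} (h : IsTwistIso φ α s) :
    IsTwistIso φ⁻¹ (Units.map (φ⁻¹ : RingAut k).toMonoidHom α⁻¹) s.symm where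
  map_add f g := by
    rw [Equiv.symm_apply_eq, h.map_add, Equiv.apply_symm_apply, Equiv.apply_symm_apply]
  map_smul c f := by
    rw [Equiv.symm_apply_eq, h.map_smul, Equiv.apply_symm_apply]
    congr 1
    exact (RingEquiv.apply_symm_apply φ c).symm
  map_mul f g := by
    rw [Equiv.symm_apply_eq, h.map_smul, h.map_mul, Equiv.apply_symm_apply,
      Equiv.apply_symm_apply, smul_smul]
    have : φ (Units.map (φ⁻¹ : RingAut k).toMonoidHom α⁻¹ : kˣ) = (α⁻¹ : kˣ) :=
      RingEquiv.apply_symm_apply φ _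
    rw [this, Units.inv_mul, one_smul]

/-- The scalar `β` produced by `t` leaves `s` as `φ β`, whence a semidirect product law on types. -/
theorem IsTwistIso.trans {A : FreeCommAlgCat k} {s t : A.Carrier ≃ A.Carrier} {φ ψ : RingAut k}
    {α β : kˣ} (h : IsTwistIso φ α s) (h' : IsTwistIso ψ β t) :
    IsTwistIso (φ * ψ) (Units.map (φ : RingAut k).toMonoidHom β * α) (t.trans s) where
  map_add f g := by simp [h.map_add, h'.map_add]
  map_smul c f := by simp [h.map_smul, h'.map_smul]
  map_mul f g := by
    simp only [Equiv.trans_apply, h'.map_mul, h.map_smul, h.map_mul, smul_smul]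
    rfl

/-- The action on the free algebra that twists the scalars by `φ` and rescales the product by
`α`, as an additive map. -/
noncomputable def twistFun (φ : RingAut k) (α : kˣ) (A : FreeCommAlgCat k) :
    A.Carrier →+ A.Carrier :=
  (MonoidAlgebra.coeffAddEquiv.symm.toAddMonoidHom.comp
    (Finsupp.liftAddHom fun m : FreeCommMagma A.gens =>
      (Finsupp.singleAddHom m).comp
        -- A monomial of length `n` contains `n - 1` products, each contributing `α`; lengths are
        -- positive, so the subtraction does not truncate.
        ((AddMonoidHom.mulLeft ((α : k) ^ (length m - 1))).comp (φ : k →+* k).toAddMonoidHom))).comp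
    MonoidAlgebra.coeffAddEquiv.toAddMonoidHom

theorem twistFun_single (φ : RingAut k) (α : kˣ) (A : FreeCommAlgCat k)
    (m : FreeCommMagma A.gens) (r : k) :
    twistFun φ α A (MonoidAlgebra.single m r) =
      MonoidAlgebra.single m ((α : k) ^ (length m - 1) * φ r) := by
  simp only [twistFun, AddMonoidHom.comp_apply]
  apply MonoidAlgebra.coeff_injective
  exact Finsupp.liftAddHom_apply_single _ _ _

theorem twistFun_smul (φ : RingAut k) (α : kˣ) (A : FreeCommAlgCat k) (c : k) (f : A.Carrier) :
    twistFun φ α A (c • f) = φ c • twistFun φ α A f := by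
  induction f using MonoidAlgebra.induction_linear with
  | zero => simp
  | add f g hf hg => rw [smul_add, map_add, hf, hg, map_add, smul_add]
  | single m r =>
    rw [MonoidAlgebra.smul_single, twistFun_single, twistFun_single, MonoidAlgebra.smul_single,
      smul_eq_mul, smul_eq_mul, map_mul]
    congr 1
    ring

theorem twistFun_mul (φ : RingAut k) (α : kˣ) (A : FreeCommAlgCat k) (f g : A.Carrier) :
    twistFun φ α A (f * g) = (α : k) • (twistFun φ α A f * twistFun φ α A g) := by
  induction f using MonoidAlgebra.induction_linear with
  | zero => simp
  | add f f' hf hf' => rw [add_mul, map_add, hf, hf', map_add, add_mul, smul_add]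
  | single m r =>
    induction g using MonoidAlgebra.induction_linear with
    | zero => simp
    | add f f' hf hf' => rw [mul_add, map_add, hf, hf', map_add, mul_add, smul_add]
    | single n t =>
      rw [MonoidAlgebra.single_mul_single, twistFun_single, twistFun_single, twistFun_single,
        MonoidAlgebra.single_mul_single, MonoidAlgebra.smul_single, smul_eq_mul, map_mul]
      congr 1
      obtain ⟨a, ha⟩ := Nat.exists_eq_succ_of_ne_zero (length_pos m).ne'
      obtain ⟨b, hb⟩ := Nat.exists_eq_succ_of_ne_zero (length_pos n).ne'
      have hl : length (m * n) = length m + length n := weight_mul _ _ _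
      rw [show length (m * n) - 1 = a + b + 1 by omega, show length m - 1 = a by omega,
        show length n - 1 = b by omega]
      ring

/-- The bijection of the free algebra that twists the scalars by `φ` and rescales the product by
`α`. -/
noncomputable def twistEquiv (φ : RingAut k) (α : kˣ) (A : FreeCommAlgCat k) :
    A.Carrier ≃ A.Carrier where
  toFun := twistFun φ α A
  invFun := twistFun φ⁻¹ (Units.map (φ⁻¹ : RingAut k).toMonoidHom α⁻¹) A
  left_inv f := by
    induction f using MonoidAlgebra.induction_linear with
    | zero => simp
    | add f g hf hg => rw [map_add, map_add, hf, hg]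
    | single m r =>
      rw [twistFun_single, twistFun_single, map_mul, map_pow]
      congr 1
      have h1 : (φ⁻¹ : RingAut k) (φ r) = r := RingEquiv.symm_apply_apply φ r
      have h2 : ((Units.map (φ⁻¹ : RingAut k).toMonoidHom α⁻¹ : kˣ) : k) * (φ⁻¹ : RingAut k) α = 1 := by
        change (φ⁻¹ : RingAut k) (α⁻¹ : kˣ) * _ = 1
        rw [← map_mul, Units.inv_mul, map_one]
      rw [h1, ← mul_assoc, ← mul_pow, h2, one_pow, one_mul]
  right_inv f := by
    induction f using MonoidAlgebra.induction_linear with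
    | zero => simp
    | add f g hf hg => rw [map_add, map_add, hf, hg]
    | single m r =>
      rw [twistFun_single, twistFun_single, map_mul, map_pow]
      congr 1
      have h1 : φ ((φ⁻¹ : RingAut k) r) = r := RingEquiv.apply_symm_apply φ r
      have h2 : φ ((Units.map (φ⁻¹ : RingAut k).toMonoidHom α⁻¹ : kˣ) : k) = (α⁻¹ : kˣ) :=
        RingEquiv.apply_symm_apply φ _
      rw [h1, h2, ← mul_assoc, ← mul_pow, Units.mul_inv, one_pow, one_mul]

theorem isTwistIso_twistEquiv (φ : RingAut k) (α : kˣ) (A : FreeCommAlgCat k) :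
    IsTwistIso φ α (twistEquiv φ α A) :=
  ⟨map_add (twistFun φ α A), twistFun_smul φ α A, twistFun_mul φ α A⟩

theorem fixesGens_twistEquiv (φ : RingAut k) (α : kˣ) : FixesGens (twistEquiv φ α) := fun A x => by
  change twistFun φ α A (gen k x) = _
  rw [gen_eq_single, twistFun_single]
  simp [length]

/-- The strongly stable automorphism of type `(φ, α)`. -/
noncomputable def twistAuto (φ : RingAut k) (α : kˣ) : Autos k :=
  conjAuto (IsTwistIso.compatible (isTwistIso_twistEquiv φ α))
    (IsTwistIso.compatible fun A => (isTwistIso_twistEquiv φ α A).symm)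

theorem isTwist_twistAuto (φ : RingAut k) (α : kˣ) : IsTwist (twistAuto φ α) φ α :=
  ⟨_, isInducedBy_conjAuto (IsTwistIso.compatible (isTwistIso_twistEquiv φ α))
    (IsTwistIso.compatible fun A => (isTwistIso_twistEquiv φ α A).symm)
    (fixesGens_twistEquiv φ α), isTwistIso_twistEquiv φ α⟩

theorem IsTwistIso.eq_of_gen {A : FreeCommAlgCat k} {s t : A.Carrier ≃ A.Carrier} {φ : RingAut k}
    {α : kˣ} (h : IsTwistIso φ α s) (h' : IsTwistIso φ α t)
    (hg : ∀ x, s (gen k x) = t (gen k x)) : s = t := by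
  ext1 f
  have hzero : ∀ {s : A.Carrier ≃ A.Carrier}, IsTwistIso φ α s → s 0 = 0 := fun h => by
    have := h.map_add 0 0
    rwa [add_zero, left_eq_add] at this
  induction f using MonoidAlgebra.induction_linear with
  | zero => rw [hzero h, hzero h']
  | add f g hf hg => rw [h.map_add, h'.map_add, hf, hg]
  | single m r =>
    rw [single_eq_smul, h.map_smul, h'.map_smul]
    congr 1
    induction m using FreeCommMagma.induction with
    | hof x => exact hg x
    | hmul a b ha hb => rw [single_mul', h.map_mul, h'.map_mul, ha, hb]

theorem IsTwist.unique {Φ Ψ : Autos k} {φ : RingAut k} {α : kˣ} (h : IsTwist Φ φ α)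
    (h' : IsTwist Ψ φ α) : Φ = Ψ := by
  obtain ⟨s, hs, hs'⟩ := h
  obtain ⟨t, ht, ht'⟩ := h'
  have : s = t := funext fun A => (hs' A).eq_of_gen (ht' A) fun x => by
    rw [hs.map_gen, ht.map_gen]
  subst this
  exact hs.unique ht

/-- The family `s` is unique; `φ` is read off from `c • x` and `α` from `x * x`. -/
theorem IsTwist.param_unique {Φ : Autos k} {φ ψ : RingAut k} {α β : kˣ} (h : IsTwist Φ φ α)
    (h' : IsTwist Φ ψ β) : φ = ψ ∧ α = β := by
  obtain ⟨s, hs, hs'⟩ := h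
  obtain ⟨t, ht, ht'⟩ := h'
  obtain rfl : s = t := funext fun A => hs.eq_family ht A
  constructor
  · ext c
    refine smul_gen_injective (A := one k) default ?_
    have h1 := (hs' (one k)).map_smul c (oneGen k)
    rwa [(ht' (one k)).map_smul, hs.map_gen, eq_comm] at h1
  · have h1 := (hs' (one k)).map_mul (oneGen k) (oneGen k)
    rw [(ht' (one k)).map_mul, hs.map_gen] at h1
    exact Units.ext (smul_left_injective k (gen_mul_gen_ne_zero _ _) h1).symm

theorem IsTwist.mul {Φ Ψ : Autos k} {φ ψ : RingAut k} {α β : kˣ} (h : IsTwist Φ φ α)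
    (h' : IsTwist Ψ ψ β) :
    IsTwist (Φ * Ψ) (φ * ψ) (Units.map (φ : RingAut k).toMonoidHom β * α) := by
  obtain ⟨s, hs, hs'⟩ := h
  obtain ⟨t, ht, ht'⟩ := h'
  exact ⟨_, hs.mul ht, fun A => (hs' A).trans (ht' A)⟩

theorem IsTwist.mem_inner {Υ : Autos k} {α : kˣ} (h : IsTwist Υ 1 α) : Υ ∈ inner k := by
  obtain ⟨s, hs, hs'⟩ := h
  rw [hs.eq_conjAuto]
  have hα : (α : k) ≠ 0 := α.ne_zero
  have hsmul : ∀ (A : FreeCommAlgCat k) (c : k) (f : A.Carrier), s A (c • f) = c • s A f :=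
    fun A c f => (hs' A).map_smul c f
  have hzero : ∀ A, s A 0 = 0 := apply_zero hs.compatible
  -- The extra factor makes `s` multiplicative: `α s(ab) = α² s(a) s(b)`.
  let η : ∀ A : FreeCommAlgCat k, A ⟶ A := fun A => ofAlgHom
    { toFun := fun a => (α : k) • s A a
      map_smul' := fun c a => by rw [hsmul, smul_comm]; rfl
      map_zero' := by rw [hzero, smul_zero]
      map_add' := fun a b => by rw [(hs' A).map_add, smul_add]
      map_mul' := fun a b => by
        rw [(hs' A).map_mul, smul_mul_smul_comm, smul_smul] }
  have hη : ∀ A, IsIso (η A) := fun A => by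
    let θ : A ⟶ A := ofAlgHom (lift fun x => (α : k)⁻¹ • gen k x)
    have hηg : ∀ x, toAlgHom (η A) (gen k x) = (α : k) • gen k x := fun x => by
      change (α : k) • s A (gen k x) = _
      rw [hs.map_gen]
    have hθg : ∀ x, toAlgHom θ (gen k x) = (α : k)⁻¹ • gen k x := fun x => lift_gen _ x
    refine ⟨θ, toAlgHom_ext_gen fun x => ?_, toAlgHom_ext_gen fun x => ?_⟩
    · rw [toAlgHom_comp, hηg, map_smul, hθg, smul_smul, mul_inv_cancel₀ hα, one_smul]; rfl
    · rw [toAlgHom_comp, hθg, map_smul, hηg, smul_smul, inv_mul_cancel₀ hα, one_smul]; rfl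
  refine ⟨(NatIso.ofComponents (F := 𝟭 _) (G := conjFunctor hs.compatible)
    (fun A => @asIso _ _ _ _ (η A) (hη A)) fun {D F} ψ => ?_).symm⟩
  refine toAlgHom_ext (A := D) (B := F) fun d => ?_
  change (α : k) • s F (toAlgHom ψ d) =
    toAlgHom (conjMap hs.compatible ψ) ((α : k) • s D d)
  rw [map_smul, conjMap_apply]

end twist

end FreeCommAlgCat

/-! ### Linear parts and retracts of the free algebra in one variable -/

namespace FreeCommNAAlgebra

open FreeCommMagma

variable {k : Type*} [Field k] {X Y : Type*}

theorem coeff_mul_of (f g : FreeCommNAAlgebra k X) (x : X) : (f * g).coeff (of x) = 0 := by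
  induction f using MonoidAlgebra.induction_linear with
  | zero => simp
  | add f f' hf hf' => rw [add_mul, MonoidAlgebra.coeff_add, Finsupp.add_apply, hf, hf', add_zero]
  | single m r =>
    induction g using MonoidAlgebra.induction_linear with
    | zero => simp
    | add f f' hf hf' =>
      rw [mul_add, MonoidAlgebra.coeff_add, Finsupp.add_apply, hf, hf', add_zero]
    | single n t =>
      rw [MonoidAlgebra.single_mul_single, MonoidAlgebra.coeff_single]
      refine Finsupp.single_eq_of_ne fun h => ?_
      have h1 : length (of x) = length m + length n := by rw [h]; exact weight_mul _ _ _
      have h2 := length_pos m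
      have h3 := length_pos n
      have h4 : length (of x) = 1 := weight_of _ _
      omega

theorem coeff_of_gen [DecidableEq X] (x y : X) :
    (gen k x).coeff (of y) = if x = y then 1 else 0 := by
  classical
  rw [gen_eq_single, MonoidAlgebra.coeff_single, Finsupp.single_apply]
  simp only [of_injective.eq_iff]

/-- The linear part of a homomorphism from the free algebra on one generator. -/
theorem coeff_hom_of [Unique X] (r : FreeCommNAAlgebra k X →ₙₐ[k] FreeCommNAAlgebra k Y)
    (d : FreeCommNAAlgebra k X) (y : Y) :
    (r d).coeff (of y) = d.coeff (of default) * (r (gen k default)).coeff (of y) := by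
  classical
  induction d using MonoidAlgebra.induction_linear with
  | zero => simp
  | add f g hf hg => rw [map_add]; simp [hf, hg, add_mul]
  | single m c =>
    rw [single_eq_smul, map_smul, MonoidAlgebra.coeff_smul, MonoidAlgebra.coeff_smul,
      Finsupp.smul_apply, Finsupp.smul_apply, smul_eq_mul, smul_eq_mul, mul_assoc]
    congr 1
    rcases eq_of_or_eq_mul m with ⟨x, rfl⟩ | ⟨a, b, rfl⟩
    · rw [← gen_eq_single, coeff_of_gen, Unique.eq_default x]
      simp
    · rw [single_mul', map_mul, coeff_mul_of, coeff_mul_of, zero_mul]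

/-- A free algebra that is a retract of the free algebra on one generator has at most one
generator. -/
theorem subsingleton_of_retract [Unique X]
    (r : FreeCommNAAlgebra k X →ₙₐ[k] FreeCommNAAlgebra k Y)
    (i : FreeCommNAAlgebra k Y → FreeCommNAAlgebra k X) (h : ∀ f, r (i f) = f) :
    Subsingleton Y := by
  classical
  refine ⟨fun x y => ?_⟩
  by_contra hne
  -- The linear parts of all values of `r` are multiples of a single vector, yet those of the
  -- generators `x` and `y` are independent.
  have h1 := coeff_hom_of r (i (gen k x)) x
  have h2 := coeff_hom_of r (i (gen k x)) y
  have h3 := coeff_hom_of r (i (gen k y)) y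
  rw [h, coeff_of_gen, if_pos rfl] at h1 h3
  rw [h, coeff_of_gen, if_neg hne, eq_comm, mul_eq_zero] at h2
  rcases h2 with h2 | h2
  · rw [h2, zero_mul] at h1; exact one_ne_zero h1
  · rw [h2, mul_zero] at h3; exact one_ne_zero h3

end FreeCommNAAlgebra

/-! ### Reduction to strongly stable automorphisms -/

namespace FreeCommAlgCat

open FreeCommNAAlgebra FreeCommMagma

variable {k : Type*} [Field k]

/-- Elements of a free algebra are morphisms from the free algebra on one generator. -/
noncomputable def pointEquiv (A : FreeCommAlgCat k) : A.Carrier ≃ (one k ⟶ A) where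
  toFun f := ofAlgHom (point f)
  invFun ψ := toAlgHom ψ (oneGen k)
  left_inv f := point_gen f _
  right_inv ψ := toAlgHom_ext_gen fun x => by
    rw [Unique.eq_default x]
    exact point_gen _ _

theorem pointEquiv_comp {A B : FreeCommAlgCat k} (f : A.Carrier) (ψ : A ⟶ B) :
    pointEquiv A f ≫ ψ = pointEquiv B (toAlgHom ψ f) := by
  rw [← Equiv.symm_apply_eq]
  exact congrArg (toAlgHom ψ) (point_gen f _)

theorem hom_ext_point {A B : FreeCommAlgCat k} {ψ χ : A ⟶ B}
    (h : ∀ x, pointEquiv A (gen k x) ≫ ψ = pointEquiv A (gen k x) ≫ χ) : ψ = χ :=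
  toAlgHom_ext_gen fun x => by
    have := h x
    rwa [pointEquiv_comp, pointEquiv_comp, (pointEquiv B).apply_eq_iff_eq] at this

theorem exists_hom_of_points {A B : FreeCommAlgCat k} (w : A.gens → (one k ⟶ B)) :
    ∃ ψ : A ⟶ B, ∀ x, pointEquiv A (gen k x) ≫ ψ = w x :=
  ⟨ofAlgHom (lift fun x => (pointEquiv B).symm (w x)), fun x => by
    rw [pointEquiv_comp, toAlgHom_ofAlgHom, lift_gen, Equiv.apply_symm_apply]⟩

theorem exists_retraction {A : FreeCommAlgCat k} (h : 𝟙 A ≠ ofAlgHom 0) :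
    ∃ (i : one k ⟶ A) (r : A ⟶ one k), i ≫ r = 𝟙 _ := by
  obtain ⟨x, -⟩ : ∃ x : A.gens, True := by
    by_contra hA
    push Not at hA
    exact h (toAlgHom_ext_gen fun x => (hA x).elim)
  refine ⟨pointEquiv A (gen k x), ofAlgHom (lift fun _ => oneGen k), ?_⟩
  rw [pointEquiv_comp, toAlgHom_ofAlgHom, lift_gen]
  exact (pointEquiv (one k)).apply_symm_apply (𝟙 _)

theorem zero_comp' {A B C : FreeCommAlgCat k} (f : B ⟶ C) :
    (ofAlgHom 0 : A ⟶ B) ≫ f = ofAlgHom 0 :=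
  toAlgHom_ext fun _ => map_zero (toAlgHom f)

theorem comp_zero' {A B C : FreeCommAlgCat k} (f : A ⟶ B) :
    f ≫ (ofAlgHom 0 : B ⟶ C) = ofAlgHom 0 := rfl

theorem id_one_ne_zero : 𝟙 (one k) ≠ ofAlgHom 0 := fun h =>
  gen_ne_zero (k := k) default (congrArg (fun f => toAlgHom f (oneGen k)) h)

/-- If the identity of the image object vanished, so would all its endomorphisms, and faithfulness
would identify `𝟙 A` with zero. -/
theorem id_ne_zero_of_map {Φ : Autos k} {A : FreeCommAlgCat k}
    (h : 𝟙 A ≠ ofAlgHom 0) : 𝟙 ((functor Φ).obj A) ≠ ofAlgHom 0 := by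
  intro h'
  apply h
  apply (functor Φ).map_injective
  rw [CategoryTheory.Functor.map_id, h', ← Category.comp_id ((functor Φ).map _), h', comp_zero']

/-- The first retraction excludes the empty set of generators, the second excludes two generators.
-/
theorem nonempty_iso_one {A : FreeCommAlgCat k} (i : one k ⟶ A) (r : A ⟶ one k)
    (h : i ≫ r = 𝟙 _) (r' : one k ⟶ A) (i' : A ⟶ one k) (h' : i' ≫ r' = 𝟙 _) :
    Nonempty (one k ≅ A) := by
  have hs : Subsingleton A.gens := subsingleton_of_retract (toAlgHom r') (toAlgHom i') fun f => by
    rw [← toAlgHom_comp, h', toAlgHom_id]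
  have hx : ∃ x : A.gens, True := by
    by_contra hA
    push Not at hA
    have h0 : 𝟙 A = ofAlgHom 0 := toAlgHom_ext_gen fun x => (hA x).elim
    apply id_one_ne_zero (k := k)
    rw [← h, ← Category.comp_id i, h0, comp_zero', zero_comp']
  obtain ⟨x, -⟩ := hx
  refine ⟨⟨pointEquiv A (gen k x), ofAlgHom (lift fun _ => oneGen k), ?_, ?_⟩⟩
  · rw [pointEquiv_comp, toAlgHom_ofAlgHom, lift_gen]
    exact (pointEquiv (one k)).apply_symm_apply (𝟙 _)
  · refine toAlgHom_ext_gen fun y => ?_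
    rw [toAlgHom_comp, toAlgHom_ofAlgHom, lift_gen, Subsingleton.elim y x]
    exact point_gen _ _

/-- Automorphisms of the category preserve the free algebra on one generator. -/
theorem nonempty_iso_obj_one (Φ : Autos k) : Nonempty (one k ≅ (functor Φ).obj (one k)) := by
  obtain ⟨i, r, h⟩ := exists_retraction (id_ne_zero_of_map (Φ := Φ) (id_one_ne_zero (k := k)))
  obtain ⟨i', r', h'⟩ := exists_retraction (id_ne_zero_of_map (Φ := Φ⁻¹) (id_one_ne_zero (k := k)))
  have e : (functor Φ).obj ((functor Φ⁻¹).obj (one k)) = one k :=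
    CategoryTheory.Functor.congr_obj (functor_inv_comp Φ) (one k)
  -- Applying `Φ` to the retraction of `Φ⁻¹(F(x))` onto `F(x)` exhibits `Φ(F(x))` as a retract of
  -- `F(x)`.
  refine nonempty_iso_one i r h (eqToHom e.symm ≫ (functor Φ).map r')
    ((functor Φ).map i' ≫ eqToHom e) ?_
  rw [Category.assoc, eqToHom_trans_assoc, eqToHom_refl, Category.id_comp, ← Functor.map_comp, h',
    CategoryTheory.Functor.map_id]

/-- Being free on points is a coproduct property, which an equivalence preserves; `η` matches the
generators of `A` with their images. -/
theorem exists_iso_obj (Φ : Autos k) (τ : one k ≅ (functor Φ).obj (one k)) (A : FreeCommAlgCat k) :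
    ∃ η : A ≅ (functor Φ).obj A, ∀ x, pointEquiv A (gen k x) ≫ η.hom =
      τ.hom ≫ (functor Φ).map (pointEquiv A (gen k x)) := by
  obtain ⟨η, hη⟩ := exists_hom_of_points
    fun x => τ.hom ≫ (functor Φ).map (pointEquiv A (gen k x))
  -- The inverse of `η` comes from lifting the generators of `A` through `Φ` to points of a preimage
  -- of `A`.
  let e := (functor Φ).objObjPreimageIso A
  have hw : ∀ x, ∃ w : one k ⟶ (functor Φ).objPreimage A,
      (functor Φ).map w = τ.inv ≫ pointEquiv A (gen k x) ≫ e.inv := fun x =>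
    (functor Φ).map_surjective _
  choose w hw using hw
  obtain ⟨κ, hκ⟩ := exists_hom_of_points w
  refine ⟨⟨η, (functor Φ).map κ ≫ e.hom, ?_, ?_⟩, hη⟩
  · refine hom_ext_point fun x => ?_
    rw [reassoc_of% hη, ← Functor.map_comp_assoc, hκ, hw]
    simp
  · obtain ⟨μ, hμ⟩ := (functor Φ).map_surjective (e.hom ≫ η)
    have : κ ≫ μ = 𝟙 A := by
      refine hom_ext_point fun x => ?_
      apply (functor Φ).map_injective
      rw [reassoc_of% hκ, Functor.map_comp, hw, hμ]
      simp [hη]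
    rw [Category.assoc, ← hμ, ← Functor.map_comp, this, CategoryTheory.Functor.map_id]

/-- Every automorphism is isomorphic to a strongly stable one. -/
theorem exists_isInducedBy_of_autos (Φ : Autos k) :
    ∃ (Ψ : Autos k) (s : ∀ A : FreeCommAlgCat k, A.Carrier ≃ A.Carrier),
      IsInducedBy Ψ s ∧ Nonempty (functor Ψ ≅ functor Φ) := by
  obtain ⟨τ⟩ := nonempty_iso_obj_one Φ
  choose η hη using exists_iso_obj Φ τ
  -- `Φ` acts on points; `τ` and `η A` bring the result back to points of `A`.
  let p : ∀ A : FreeCommAlgCat k, (one k ⟶ A) ≃ (one k ⟶ A) := fun A =>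
    (Functor.FullyFaithful.ofFullyFaithful (functor Φ)).homEquiv.trans
      (Iso.homCongr τ.symm (η A).symm)
  let s : ∀ A : FreeCommAlgCat k, A.Carrier ≃ A.Carrier := fun A =>
    (pointEquiv A).trans ((p A).trans (pointEquiv A).symm)
  have hsp : ∀ A f, pointEquiv A (s A f) =
      τ.hom ≫ (functor Φ).map (pointEquiv A f) ≫ (η A).inv := fun A f =>
    (pointEquiv A).apply_symm_apply (p A (pointEquiv A f))
  have key : ∀ {D F : FreeCommAlgCat k} (ψ : D ⟶ F) (d : D.Carrier),
      toAlgHom ((η D).hom ≫ (functor Φ).map ψ ≫ (η F).inv) (s D d) = s F (toAlgHom ψ d) := by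
    intro D F ψ d
    apply (pointEquiv F).injective
    rw [← pointEquiv_comp, hsp, hsp, ← pointEquiv_comp]
    simp
  have hs : Compatible s := fun D F ψ => ⟨_, key (ofAlgHom ψ)⟩
  have hs' : Compatible fun A => (s A).symm := by
    intro D F ψ
    obtain ⟨χ, hχ⟩ := (functor Φ).map_surjective ((η D).inv ≫ ofAlgHom ψ ≫ (η F).hom)
    refine ⟨toAlgHom χ, fun d => ?_⟩
    obtain ⟨d, rfl⟩ := (s D).surjective d
    have := key χ d
    rw [hχ] at this
    simp only [Category.assoc, Iso.hom_inv_id, Iso.hom_inv_id_assoc, Category.comp_id] at this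
    rw [Equiv.eq_symm_apply, Equiv.symm_apply_apply, ← this]
    rfl
  have hg : FixesGens s := by
    intro A x
    apply (pointEquiv A).injective
    rw [hsp, ← Category.assoc, ← hη, Category.assoc, Iso.hom_inv_id, Category.comp_id]
  refine ⟨conjAuto hs hs', s, isInducedBy_conjAuto hs hs' hg,
    ⟨NatIso.ofComponents (F := conjFunctor hs) η fun {D F} ψ => ?_⟩⟩
  change conjMap hs ψ ≫ (η F).hom = (η D).hom ≫ (functor Φ).map ψ
  rw [← Iso.eq_comp_inv, Category.assoc]
  refine toAlgHom_ext fun d => ?_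
  obtain ⟨d, rfl⟩ := (s D).surjective d
  rw [conjMap_apply, key]

/-! ### The quotient by the inner automorphisms -/

theorem mk_eq_of_iso {Φ Ψ : Autos k} (h : Nonempty (functor Ψ ≅ functor Φ)) :
    (QuotientGroup.mk Φ : Autos k ⧸ inner k) = QuotientGroup.mk Ψ := by
  obtain ⟨e⟩ := h
  exact QuotientGroup.eq.2
    ⟨(Functor.isoWhiskerRight e (functor Φ⁻¹)).trans (eqToIso (functor_comp_inv Φ))⟩

theorem IsTwist.eq_twistAuto {Φ : Autos k} {φ : RingAut k} {α : kˣ} (h : IsTwist Φ φ α) :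
    Φ = twistAuto φ α :=
  h.unique (isTwist_twistAuto φ α)

theorem twistAuto_mul (φ ψ : RingAut k) (α β : kˣ) :
    twistAuto φ α * twistAuto ψ β =
      twistAuto (φ * ψ) (Units.map (φ : RingAut k).toMonoidHom β * α) :=
  ((isTwist_twistAuto φ α).mul (isTwist_twistAuto ψ β)).eq_twistAuto

theorem twistAuto_eq_mul (φ : RingAut k) (α : kˣ) :
    twistAuto φ α = twistAuto 1 α * twistAuto φ 1 := by
  rw [twistAuto_mul, one_mul, map_one, one_mul]

/-- The homomorphism from the field automorphisms to the outer automorphisms of the category. -/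
noncomputable def twistHom (k : Type*) [Field k] : RingAut k →* Autos k ⧸ inner k :=
  MonoidHom.mk' (fun φ => QuotientGroup.mk (twistAuto φ 1)) fun φ ψ => by
    rw [← QuotientGroup.mk_mul, twistAuto_mul, map_one, one_mul]

theorem mk_twistAuto (φ : RingAut k) (α : kˣ) :
    (QuotientGroup.mk (twistAuto φ α) : Autos k ⧸ inner k) = twistHom k φ := by
  rw [twistAuto_eq_mul, QuotientGroup.mk_mul,
    (QuotientGroup.eq_one_iff _).2 (isTwist_twistAuto 1 α).mem_inner, one_mul]
  rfl

theorem eq_one_of_twistAuto_mem_inner {φ : RingAut k} {α : kˣ} (h : twistAuto φ α ∈ inner k) :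
    φ = 1 := by
  obtain ⟨s, hs, hs'⟩ := isTwist_twistAuto φ α
  rw [hs.eq_conjAuto] at h
  obtain ⟨e⟩ := h
  let η : one k ⟶ one k := e.hom.app (one k)
  let θ : one k ⟶ one k := e.inv.app (one k)
  have hηθ : η ≫ θ = 𝟙 _ := e.hom_inv_id_app (one k)
  have hθη : θ ≫ η = 𝟙 _ := e.inv_hom_id_app (one k)
  obtain ⟨a, ha⟩ : ∃ a : k, toAlgHom η (oneGen k) = a • oneGen k := by
    refine eq_smul_gen_of_lift_eq_gen (u := toAlgHom θ (oneGen k)) ?_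
    have : toAlgHom η = FreeCommNAAlgebra.lift fun _ : (one k).gens => toAlgHom η (oneGen k) :=
      lift_eq fun x => by rw [Unique.eq_default x]
    rw [← this, ← toAlgHom_comp, hθη, toAlgHom_id]
  have ha0 : a ≠ 0 := by
    rintro rfl
    have h1 := congrArg (toAlgHom θ) ha
    rw [zero_smul, map_zero, ← toAlgHom_comp, hηθ, toAlgHom_id] at h1
    exact gen_ne_zero _ h1
  ext c
  let ψ : one k ⟶ one k := pointEquiv (one k) (c • oneGen k)
  have hψ : toAlgHom ψ (oneGen k) = c • oneGen k := point_gen _ _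
  -- Naturality at `x ↦ c x`, whose conjugate is `x ↦ φ(c) x`; comparing values at `x` gives `φ(c) a
  -- = a c`.
  have hnat : conjMap hs.compatible ψ ≫ η = η ≫ ψ := e.hom.naturality ψ
  have h1 : toAlgHom (conjMap hs.compatible ψ) (oneGen k) = φ c • oneGen k := by
    have := conjMap_apply hs.compatible ψ (oneGen k)
    rwa [hs.map_gen, hψ, (hs' _).map_smul, hs.map_gen] at this
  have h2 := congrArg (fun f => toAlgHom f (oneGen k)) hnat
  simp only [toAlgHom_comp] at h2
  rw [h1, ha, map_smul, map_smul, ha, hψ, smul_smul, smul_smul] at h2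
  have h3 := smul_gen_injective (A := one k) _ h2
  rw [mul_comm a] at h3
  exact mul_right_cancel₀ ha0 h3

theorem twistHom_bijective [CharZero k] : Function.Bijective (twistHom k) := by
  refine ⟨(injective_iff_map_eq_one _).2 fun φ h =>
    eq_one_of_twistAuto_mem_inner ((QuotientGroup.eq_one_iff _).1 h), fun x => ?_⟩
  obtain ⟨Φ, rfl⟩ := QuotientGroup.mk_surjective x
  obtain ⟨Ψ, s, hs, h⟩ := exists_isInducedBy_of_autos Φ
  obtain ⟨φ, α, hφ⟩ := exists_isTwistIso hs.compatible hs.compatible_symm hs.map_gen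
  have hΨ : IsTwist Ψ φ α := ⟨s, hs, hφ⟩
  exact ⟨φ, by rw [mk_eq_of_iso h, hΨ.eq_twistAuto, mk_twistAuto]⟩

end FreeCommAlgCat

theorem mainTheorem3 (k : Type*) [Field k] [CharZero k] :
    ∃ e : (FreeCommAlgCat.Autos k ⧸ FreeCommAlgCat.inner k) ≃* RingAut k,
      (∀ Φ : FreeCommAlgCat.Autos k, FreeCommAlgCat.IsStronglyStable Φ →
        ∃! p : RingAut k × kˣ, FreeCommAlgCat.IsTwist Φ p.1 p.2) ∧
      (∀ (φ : RingAut k) (α : kˣ),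
        ∃! Φ : FreeCommAlgCat.Autos k, FreeCommAlgCat.IsTwist Φ φ α) ∧
      (∀ (φ : RingAut k) (α : kˣ) (Φ Υ Ψ : FreeCommAlgCat.Autos k),
        FreeCommAlgCat.IsTwist Φ φ α → FreeCommAlgCat.IsTwist Υ 1 α →
        FreeCommAlgCat.IsTwist Ψ φ 1 → Φ = Υ * Ψ ∧ Υ ∈ FreeCommAlgCat.inner k) ∧
      (∀ (φ : RingAut k) (α : kˣ) (Φ : FreeCommAlgCat.Autos k),
        FreeCommAlgCat.IsTwist Φ φ α → e (QuotientGroup.mk Φ) = φ) := by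
  refine ⟨(MulEquiv.ofBijective _ FreeCommAlgCat.twistHom_bijective).symm, ?_, ?_, ?_, ?_⟩
  · rintro Φ ⟨s, hs⟩
    obtain ⟨φ, α, hφ⟩ :=
      FreeCommAlgCat.exists_isTwistIso hs.compatible hs.compatible_symm hs.map_gen
    have h : FreeCommAlgCat.IsTwist Φ φ α := ⟨s, hs, hφ⟩
    refine ⟨(φ, α), h, fun p hp => ?_⟩
    obtain ⟨h1, h2⟩ := hp.param_unique h
    exact Prod.ext h1 h2
  · exact fun φ α => ⟨_, FreeCommAlgCat.isTwist_twistAuto φ α, fun Φ h => h.eq_twistAuto⟩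
  · intro φ α Φ Υ Ψ hΦ hΥ hΨ
    refine ⟨?_, hΥ.mem_inner⟩
    rw [hΦ.eq_twistAuto, hΥ.eq_twistAuto, hΨ.eq_twistAuto, FreeCommAlgCat.twistAuto_eq_mul]
  · intro φ α Φ h
    rw [MulEquiv.symm_apply_eq, h.eq_twistAuto, FreeCommAlgCat.mk_twistAuto]
    rfl
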